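/- Let $n\ge 0$. For a graph $G$ with $n$ vertices let $\mathrm{Part}(G)\vdash n$ be the partition formed by the numbers of vertices of its connected components, and let $\ell(\lambda)$ be the number of parts of a partition $\lambda$. Let $$X_G=\sum_{\kappa}\prod_{v\in V(G)}x_{\kappa(v)}$$ be the chromatic symmetric function (the sum is over all proper colorings $\kappa:V(G)\to\mathbb{Z}^+$), and let $$U_G(x,y)=\sum_{A\subseteq E(G)}\Big(\prod_{i=1}^{n}x_i^{c_i(A)}\Big)(y-1)^{|A|-n+k(A)}$$ be the $U$-polynomial, where $k(A)$ is the number of connected components of the spanning subgraph $(V(G),A)$ and $c_i(A)$ is the number of those with exactly $i$ vertices. For $\lambda=(\lambda_1,\dots,\lambda_\ell)\vdash n$ write $[\lambda]U_G\in\mathbb{Q}[y]$ for the coefficient of $x_{\lambda_1}\cdots x_{\lambda_\ell}$ in $U_G$ (for a forest this is a constant). Let $B=\{X_{G_\lambda}\mid\lambda\vdash n\}$ be a forest-basis: for every $\lambda\vdash n$, $G_\lambda$ is a forest with $\mathrm{Part}(G_\lambda)=\lambda$. For a forest $F$ with $n$ vertices and $\mathrm{Part}(F)=\mu$ let $[\lambda]X_{F,B}\in\mathbb{Q}$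 be the coefficients in the expansion $X_F=\sum_{\lambda\vdash n}[\lambda]X_{F,B}\,X_{G_\lambda}$, and for an integer $k\ge 0$ put $$X^k_{F,B}=\sum_{\lambda\vdash n,\ \ell(\lambda)\le\ell(\mu)+k}[\lambda]X_{F,B}\,X_{G_\lambda}.$$ Let $F_1,F_2$ be forests with $n$ vertices such that $\mathrm{Part}(F_1)=\mathrm{Part}(F_2)=\mu$, and suppose that $X^k_{F_1,B}-X^k_{F_2,B}=0$ for some integer $k\ge 0$. Then the expansions of $X_{F_1}$ and $X_{F_2}$ in $B$ exist and are unique, and: 1. There are $t\ge 0$ and finite families (repetitions allowed) of forests $P_1,\dots,P_t$ and $N_1,\dots,N_t$ with $n$ vertices such that $\ell(\mathrm{Part}(P_i))=\ell(\mathrm{Part}(N_i))=\ell(\mu)+k+1$ for all $i$, and $$X_{F_1}-X_{F_2}=\sum_{i=1}^{t}X_{P_i}-\sum_{i=1}^{t}X_{N_i}\quad\text{and}\quad U_{F_1}-U_{F_2}=\sum_{i=1}^{t}U_{P_i}-\sum_{i=1}^{t}U_{N_i}.$$ 2. For all $\lambda\vdash n$ with $\ell(\lambda)\le\ell(\mu)+k+1$,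 $$[\lambda]X_{F_1,B}-[\lambda]X_{F_2,B}=[\lambda]U_{F_1}-[\lambda]U_{F_2}.$$ -/

import Mathlib

/-- The chromatic symmetric function `X_G = ∑_κ ∏_v x_{κ(v)}` of a graph on a finite vertex set,
the sum ranging over all proper colorings `κ` of `G` by positive integers, as a formal power series
in the variables `x_1, x_2, …` with rational coefficients: the coefficient of a monomial `m` is the
number of proper colorings `κ` with `∏_v x_{κ(v)} = m`. -/
noncomputable def SimpleGraph.csf {V : Type*} [Fintype V] (G : SimpleGraph V) :
    MvPowerSeries ℕ+ ℚ :=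
  fun m => (Nat.card {κ : G.Coloring ℕ+ // ∑ v, Finsupp.single (κ v) 1 = m} : ℚ)

/-- Only finitely many proper colorings contribute to a given monomial. -/
theorem SimpleGraph.finite_coloring_of_monomial {V : Type*} [Fintype V] (G : SimpleGraph V)
    (m : ℕ+ →₀ ℕ) : Finite {κ : G.Coloring ℕ+ // ∑ v, Finsupp.single (κ v) 1 = m} := by
  classical
  refine Finite.of_injective
    (β := V → m.support)
    (fun κ v => ⟨κ.1 v, ?_⟩) ?_
  · rw [Finsupp.mem_support_iff]
    intro h
    have h' := DFunLike.congr_fun κ.2 (κ.1 v)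
    rw [h, Finsupp.finsetSum_apply] at h'
    have := (Finset.sum_eq_zero_iff.mp h') v (Finset.mem_univ v)
    simp at this
  · intro κ κ' h
    apply Subtype.ext
    ext v
    have := congrFun h v
    simpa using this

open scoped Classical in
/-- The partition `Part(G)` of `n` formed by the numbers of vertices of the connected components
of a graph `G` with `n` vertices. -/
noncomputable def SimpleGraph.part {n : ℕ} (G : SimpleGraph (Fin n)) : n.Partition where
  parts := (Finset.univ : Finset G.ConnectedComponent).val.map (fun c => c.supp.ncard)
  parts_pos := by
    intro i hi
    obtain ⟨c, -, rfl⟩ := Multiset.mem_map.mp hi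
    exact (Set.ncard_pos (Set.toFinite _)).mpr c.nonempty_supp
  parts_sum := by
    change ∑ c : G.ConnectedComponent, c.supp.ncard = n
    have h := Finset.card_eq_sum_card_fiberwise (s := (Finset.univ : Finset (Fin n)))
      (t := (Finset.univ : Finset G.ConnectedComponent)) (f := G.connectedComponentMk)
      (fun _ _ => Finset.mem_coe.mpr (Finset.mem_univ _))
    rw [Finset.card_univ, Fintype.card_fin] at h
    refine Eq.trans ?_ h.symm
    refine Finset.sum_congr rfl fun c _ => ?_
    rw [← Set.ncard_coe_finset]
    congr 1
    ext v
    simp [SimpleGraph.ConnectedComponent.mem_supp_iff]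

/-- The length `ℓ(ν)`, the number of parts of the partition `ν`. -/
def Nat.Partition.length {n : ℕ} (ν : n.Partition) : ℕ := Multiset.card ν.parts

/-- The `U`-polynomial
`U_G(x, y) = ∑_{A ⊆ E(G)} (∏_{i=1}^{|V|} x_i ^ c_i(A)) (y - 1) ^ (|A| - r(A))`
as a polynomial in the variables `x_i` over `ℚ[y]`. Here `c_i(A)` is the number of connected
components with `i` vertices of the spanning subgraph `(V, A)`, and `r(A) = |V| - k(A)`, where
`k(A)` is its number of connected components. The natural subtraction below is exact, since
`|V| ≤ |A| + k(A)` always holds. -/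
noncomputable def SimpleGraph.uPoly {V : Type*} [Fintype V] (G : SimpleGraph V) :
    MvPolynomial ℕ (Polynomial ℚ) :=
  open scoped Classical in
  ∑ A ∈ G.edgeFinset.powerset,
    (∏ i ∈ Finset.Icc 1 (Fintype.card V),
      MvPolynomial.X i ^
        Nat.card {c : (SimpleGraph.fromEdgeSet (A : Set (Sym2 V))).ConnectedComponent //
          c.supp.ncard = i}) *
    MvPolynomial.C ((Polynomial.X - 1) ^
      (A.card + Nat.card (SimpleGraph.fromEdgeSet (A : Set (Sym2 V))).ConnectedComponent
        - Fintype.card V))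

/-- The coefficient `[ν]U_G` of the monomial `x_ν = x_{ν_1} ⋯ x_{ν_ℓ}` in `U_G(x, y)`, an element
of `ℚ[y]`. -/
noncomputable def SimpleGraph.uCoeff {n : ℕ} (G : SimpleGraph (Fin n)) (ν : n.Partition) :
    Polynomial ℚ :=
  MvPolynomial.coeff (Multiset.toFinsupp ν.parts) G.uPoly

/-- The assignment `ν ↦ B ν` of graphs to the partitions of `n` defines a chromatic-basis
`{X_{B ν} | ν ⊢ n}`: each `B ν` has partition `ν`. -/
def IsChromaticBasis {n : ℕ} (B : n.Partition → SimpleGraph (Fin n)) : Prop :=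
  ∀ ν, (B ν).part = ν

/-- A forest-basis is a chromatic-basis all of whose graphs are forests. -/
def IsForestBasis {n : ℕ} (B : n.Partition → SimpleGraph (Fin n)) : Prop :=
  IsChromaticBasis B ∧ ∀ ν, (B ν).IsAcyclic

/-- `c` is a family of coefficients of an expansion `X_G = ∑_ν c_ν X_{B ν}`. -/
def IsCSFExpansion {n : ℕ} (B : n.Partition → SimpleGraph (Fin n)) (G : SimpleGraph (Fin n))
    (c : n.Partition → ℚ) : Prop :=
  G.csf = ∑ ν, c ν • (B ν).csf

/-- The coefficients `ν ↦ [ν]X_{G, B}` of `X_G` expressed in the chromatic-basis `B`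
(the family `c` with `X_G = ∑_ν c_ν X_{B ν}`). -/
noncomputable def csfCoeff {n : ℕ} (B : n.Partition → SimpleGraph (Fin n))
    (G : SimpleGraph (Fin n)) : n.Partition → ℚ :=
  Classical.epsilon (IsCSFExpansion B G)

/-- The truncation `X^k_{G, B} = ∑_{ν ⊢ n, ℓ(ν) ≤ ℓ(Part(G)) + k} [ν]X_{G, B} X_{B ν}`. -/
noncomputable def csfTrunc {n : ℕ} (B : n.Partition → SimpleGraph (Fin n))
    (G : SimpleGraph (Fin n)) (k : ℕ) : MvPowerSeries ℕ+ ℚ :=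
  ∑ ν : n.Partition with ν.length ≤ G.part.length + k, csfCoeff B G ν • (B ν).csf

/-! For a forest `F`, record in `partVec F` how many spanning subgraphs have each partition.
Acyclicity fixes the number of edges of a subgraph by its number of components, so both `X_F` and
`U_F` are linear images of this vector: `csfMap` expands in signed power sums and is injective, and
`uMap` sends coordinates to monomials. Everything thus reduces to vectors indexed by partitions,
where `partVec F` is triangular: it is 1 at `F.part` and 0 at every other partition with at most as
many parts.

Part 2 is this triangularity. For part 1, replacing an edge `vw` by `uw` next to an edge `uv`
changes `partVec` by a difference of two forests with one more component. Such moves turn any forest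
into a star forest determined up to relabelling by its partition, so forests with equal partition
are congruent modulo `forestLattice` one level up (`partVec_sub_mem_forestLattice`). A lattice
element of level `L` whose coordinates of length `L` vanish therefore lies in level `L + 1`. The
hypothesis supplies this vanishing `k + 1` times. -/

namespace SimpleGraph

/-! ### Components of graphs and forests under adding an edge. -/

section Components

variable {V : Type*}

theorem reachable_sup_edge_iff {G : SimpleGraph V} {u v : V} (a b : V) :
    (G ⊔ edge u v).Reachable a b ↔ G.Reachable a b ∨
      (G.Reachable a u ∧ G.Reachable v b) ∨ (G.Reachable a v ∧ G.Reachable u b) := by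
  constructor
  · rintro ⟨p⟩
    induction p with
    | nil => exact Or.inl (Reachable.refl _)
    | @cons a c b h p ih =>
      rw [sup_adj, edge_adj] at h
      rcases h with h | ⟨⟨rfl, rfl⟩ | ⟨rfl, rfl⟩, -⟩
      · have h := h.reachable
        rcases ih with ih | ⟨h1, h2⟩ | ⟨h1, h2⟩
        · exact Or.inl (h.trans ih)
        · exact Or.inr (Or.inl ⟨h.trans h1, h2⟩)
        · exact Or.inr (Or.inr ⟨h.trans h1, h2⟩)
      · rcases ih with ih | ⟨h1, h2⟩ | ⟨h1, h2⟩
        · exact Or.inr (Or.inl ⟨.refl _, ih⟩)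
        · exact Or.inr (Or.inl ⟨.refl _, h2⟩)
        · exact Or.inl h2
      · rcases ih with ih | ⟨h1, h2⟩ | ⟨h1, h2⟩
        · exact Or.inr (Or.inr ⟨.refl _, ih⟩)
        · exact Or.inl h2
        · exact Or.inr (Or.inr ⟨.refl _, h2⟩)
  · have hmono {x y : V} (h : G.Reachable x y) : (G ⊔ edge u v).Reachable x y := h.mono le_sup_left
    have huv : (G ⊔ edge u v).Reachable u v := by
      by_cases h : u = v
      · exact h ▸ .refl _
      · exact Adj.reachable (by simp [edge_adj, h])
    rintro (h | ⟨h1, h2⟩ | ⟨h1, h2⟩)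
    · exact hmono h
    · exact ((hmono h1).trans huv).trans (hmono h2)
    · exact ((hmono h1).trans huv.symm).trans (hmono h2)

theorem card_connectedComponent_sup_edge [Finite V] {G : SimpleGraph V} {u v : V}
    (h : ¬ G.Reachable u v) :
    Nat.card (G ⊔ edge u v).ConnectedComponent + 1 = Nat.card G.ConnectedComponent := by
  classical
  have := Fintype.ofFinite G.ConnectedComponent
  have key : Nat.card {c : G.ConnectedComponent // c ≠ G.connectedComponentMk v} =
      Nat.card (G ⊔ edge u v).ConnectedComponent := by
    refine Nat.card_eq_of_bijective
      (fun c => c.1.map (Hom.ofLE (le_sup_left : G ≤ G ⊔ edge u v))) ⟨?_, ?_⟩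
    · rintro ⟨c, hc⟩ ⟨d, hd⟩ hcd
      induction c using ConnectedComponent.ind with | _ a => ?_
      induction d using ConnectedComponent.ind with | _ b => ?_
      simp only [ConnectedComponent.map_mk, Hom.coe_ofLE, id_eq, ConnectedComponent.eq,
        reachable_sup_edge_iff, ne_eq] at hcd hc hd
      rw [Subtype.mk.injEq, ConnectedComponent.eq]
      rcases hcd with hcd | ⟨h1, h2⟩ | ⟨h1, h2⟩
      · exact hcd
      · exact absurd h2.symm hd
      · exact absurd h1 hc
    · intro c
      induction c using ConnectedComponent.ind with | _ a => ?_
      by_cases ha : G.Reachable a v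
      · refine ⟨⟨G.connectedComponentMk u, by simpa using h⟩, ?_⟩
        simp only [ConnectedComponent.map_mk, Hom.coe_ofLE, id_eq, ConnectedComponent.eq,
          reachable_sup_edge_iff]
        exact Or.inr (Or.inl ⟨.refl _, ha.symm⟩)
      · exact ⟨⟨G.connectedComponentMk a, by simpa using ha⟩, rfl⟩
  rw [← key, Nat.card_eq_fintype_card, Nat.card_eq_fintype_card, Fintype.card_subtype_compl,
    Fintype.card_subtype_eq]
  exact Nat.sub_add_cancel (Fintype.card_pos_iff.mpr ⟨G.connectedComponentMk v⟩)

theorem ncard_edgeSet_sup_edge [Finite V] {G : SimpleGraph V} {u v : V} (huv : u ≠ v)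
    (h : ¬ G.Adj u v) : (G ⊔ edge u v).edgeSet.ncard = G.edgeSet.ncard + 1 := by
  rw [edgeSet_sup, edgeSet_edge_of_ne huv, Set.union_singleton,
    Set.ncard_insert_of_notMem (by simpa using h) (Set.toFinite _)]

theorem sdiff_edge_sup_edge {G : SimpleGraph V} {u v : V} (h : G.Adj u v) :
    G \ edge u v ⊔ edge u v = G :=
  sdiff_sup_cancel (by rw [edge_le_iff]; exact Or.inr h)

theorem not_adj_sdiff_edge {G : SimpleGraph V} {u v : V} : ¬ (G \ edge u v).Adj u v := by
  rw [sdiff_adj, edge_adj]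
  intro h
  exact h.2 ⟨Or.inl ⟨rfl, rfl⟩, h.1.ne⟩

/-- Deleting an edge of a forest separates its ends. -/
theorem IsAcyclic.not_reachable_of_sup_edge {G : SimpleGraph V} {u v : V} (huv : u ≠ v)
    (h : ¬ G.Adj u v) (hG : (G ⊔ edge u v).IsAcyclic) : ¬ G.Reachable u v := by
  intro hr
  rcases (isAcyclic_sup_fromEdgeSet_iff.mp hG).2 hr with h' | h'
  exacts [huv h', h h']

/-- Deleting an edge of a forest creates exactly one new component. This count makes the sign in `X`
depend only on the partition and kills the power of `y - 1` in `U`. -/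
theorem IsAcyclic.card_edgeSet_add_card_connectedComponent [Finite V] {G : SimpleGraph V}
    (hG : G.IsAcyclic) : G.edgeSet.ncard + Nat.card G.ConnectedComponent = Nat.card V := by
  induction hm : G.edgeSet.ncard generalizing G with
  | zero =>
    rw [Set.ncard_eq_zero, edgeSet_eq_empty] at hm
    subst hm
    rw [zero_add]
    refine (Nat.card_eq_of_bijective (fun a => connectedComponentMk ⊥ a) ⟨fun a b hab => ?_, ?_⟩).symm
    · simpa using hab
    · intro c
      induction c using ConnectedComponent.ind with | _ a => exact ⟨a, rfl⟩
  | succ m ih =>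
    obtain ⟨e, he⟩ := Set.nonempty_of_ncard_ne_zero (by omega : G.edgeSet.ncard ≠ 0)
    induction e with | h u v => ?_
    rw [mem_edgeSet] at he
    have hE := sdiff_edge_sup_edge he
    have hA : (G \ edge u v).IsAcyclic := hG.anti sdiff_le
    have h1 := ncard_edgeSet_sup_edge he.ne (not_adj_sdiff_edge (G := G))
    have h2 := card_connectedComponent_sup_edge
      (IsAcyclic.not_reachable_of_sup_edge he.ne (not_adj_sdiff_edge (G := G)) (hE.symm ▸ hG))
    rw [hE] at h1 h2
    have := ih hA (by omega)
    omega

/-- An acyclic subgraph with the same reachability as `F` is already maximal among acyclic subgraphs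
of `F`. -/
theorem IsAcyclic.eq_of_le_of_reachable {F H : SimpleGraph V} (hF : F.IsAcyclic) (hle : H ≤ F)
    (h : ∀ u v, F.Reachable u v → H.Reachable u v) : H = F := by
  have hr : H.Reachable = F.Reachable := by
    ext u v
    exact ⟨fun h => h.mono hle, h u v⟩
  exact ((maximal_isAcyclic_iff_reachable_eq hle (hF.anti hle)).mpr hr).eq_of_ge ⟨le_rfl, hF⟩ hle |>.symm

end Components

/-! ### Partitions of component sizes. -/

section Part

variable {n : ℕ}

theorem part_length (G : SimpleGraph (Fin n)) : G.part.length = Nat.card G.ConnectedComponent := by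
  classical
  rw [Nat.card_eq_fintype_card]
  simp only [part, Nat.Partition.length, Multiset.card_map]
  rw [Finset.card_val, Finset.card_univ]

/-- The components of `H` surject onto those of `K`; if they are no more numerous, the surjection is
a bijection. -/
theorem reachable_of_le_of_length_le {H K : SimpleGraph (Fin n)} (h : H ≤ K)
    (hl : H.part.length ≤ K.part.length) (u v : Fin n) (huv : K.Reachable u v) :
    H.Reachable u v := by
  rw [part_length, part_length] at hl
  have hs := ConnectedComponent.surjective_map_ofLE h
  have hb := (Nat.bijective_iff_surjective_and_card _).mpr
    ⟨hs, le_antisymm hl (Nat.card_le_card_of_surjective _ hs)⟩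
  have := @hb.1 (H.connectedComponentMk u) (H.connectedComponentMk v)
    (by simpa using huv)
  simpa using this

/-- Graphs whose reachability relations correspond under a permutation have the same partition. -/
theorem part_eq_of_reachable_iff {H K : SimpleGraph (Fin n)} (σ : Equiv.Perm (Fin n))
    (h : ∀ u v, H.Reachable u v ↔ K.Reachable (σ u) (σ v)) : H.part = K.part := by
  classical
  let e : H.ConnectedComponent ≃ K.ConnectedComponent :=
    Quot.congr σ h
  apply Nat.Partition.ext
  simp only [part]
  rw [← Finset.map_univ_equiv e, Finset.map_val, Multiset.map_map]
  refine Multiset.map_congr rfl fun c _ => ?_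
  have : (e c).supp = σ '' c.supp := by
    induction c using ConnectedComponent.ind with | _ a => ?_
    ext b
    have he : e (H.connectedComponentMk a) = K.connectedComponentMk (σ a) := rfl
    rw [he, Equiv.image_eq_preimage_symm]
    simp only [ConnectedComponent.mem_supp_iff, ConnectedComponent.eq, Set.mem_preimage]
    rw [h, Equiv.apply_symm_apply]
  simp only [Function.comp_apply, Equiv.coe_toEmbedding, this]
  exact (Set.ncard_image_of_injective _ σ.injective).symm

theorem part_eq_of_reachable_eq {H K : SimpleGraph (Fin n)}
    (h : ∀ u v, H.Reachable u v ↔ K.Reachable u v) : H.part = K.part :=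
  part_eq_of_reachable_iff (Equiv.refl _) h

theorem part_eq_of_le_of_length_le {H K : SimpleGraph (Fin n)} (h : H ≤ K)
    (hl : H.part.length ≤ K.part.length) : H.part = K.part :=
  part_eq_of_reachable_eq fun u v =>
    ⟨fun h' => h'.mono h, reachable_of_le_of_length_le h hl u v⟩

/-- Two graphs with the same partition have reachability relations that correspond under a
permutation, which can be chosen to respect given representatives of the components. -/
theorem exists_perm_of_part_eq {H K : SimpleGraph (Fin n)} (h : H.part = K.part)
    (r : H.ConnectedComponent → Fin n) (hr : ∀ c, H.connectedComponentMk (r c) = c)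
    (s : K.ConnectedComponent → Fin n) (hs : ∀ c, K.connectedComponentMk (s c) = c) :
    ∃ σ : Equiv.Perm (Fin n), (∀ u v, H.Reachable u v ↔ K.Reachable (σ u) (σ v)) ∧
      ∀ v, σ (r (H.connectedComponentMk v)) = s (K.connectedComponentMk (σ v)) := by
  classical
  have hp := congrArg Nat.Partition.parts h
  simp only [part] at hp
  obtain ⟨e, he⟩ : ∃ e : H.ConnectedComponent ≃ K.ConnectedComponent,
      ∀ c, (e c).supp.ncard = c.supp.ncard := by
    have hcard (i : ℕ) : Fintype.card {c : H.ConnectedComponent // c.supp.ncard = i} =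
        Fintype.card {c : K.ConnectedComponent // c.supp.ncard = i} := by
      have := congrArg (Multiset.count i) hp
      rw [Multiset.count_map, Multiset.count_map] at this
      rw [Fintype.card_subtype, Fintype.card_subtype, Finset.card_def, Finset.card_def,
        Finset.filter_val, Finset.filter_val]
      simp only [eq_comm (a := i)] at this
      convert this
    let E := (Equiv.sigmaFiberEquiv (fun c : H.ConnectedComponent => c.supp.ncard)).symm.trans
      ((Equiv.sigmaCongrRight fun i => Fintype.equivOfCardEq (hcard i)).trans
        (Equiv.sigmaFiberEquiv (fun c : K.ConnectedComponent => c.supp.ncard)))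
    exact ⟨E, fun c => (Fintype.equivOfCardEq (hcard c.supp.ncard) ⟨c, rfl⟩).2⟩
  have hf (c : H.ConnectedComponent) : ∃ f : c.supp ≃ (e c).supp,
      (f ⟨r c, hr c⟩ : Fin n) = s (e c) := by
    have : Nonempty (c.supp ≃ (e c).supp) := by
      rw [← Fintype.card_eq, ← Nat.card_eq_fintype_card, ← Nat.card_eq_fintype_card,
        Nat.card_coe_set_eq, Nat.card_coe_set_eq, he]
    obtain ⟨f⟩ := this
    -- The swap corrects an arbitrary bijection so that representative goes to representative.
    exact ⟨f.trans (Equiv.swap (f ⟨r c, hr c⟩) ⟨s (e c), hs (e c)⟩), by simp⟩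
  choose f hf using hf
  let σ : Equiv.Perm (Fin n) :=
    (Equiv.sigmaFiberEquiv H.connectedComponentMk).symm.trans
      ((Equiv.sigmaCongr e f).trans (Equiv.sigmaFiberEquiv K.connectedComponentMk))
  have hσ (c : H.ConnectedComponent) (v : Fin n) (hv : H.connectedComponentMk v = c) :
      σ v = f c ⟨v, hv⟩ := by subst hv; rfl
  have hσ' (v : Fin n) : K.connectedComponentMk (σ v) = e (H.connectedComponentMk v) := by
    rw [hσ _ v rfl]
    exact (f _ ⟨v, rfl⟩).2
  refine ⟨σ, fun u v => ?_, fun v => ?_⟩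
  · rw [← ConnectedComponent.eq, ← ConnectedComponent.eq, hσ', hσ', e.apply_eq_iff_eq]
  · rw [hσ', hσ (H.connectedComponentMk v) _ (hr _), hf]

end Part

end SimpleGraph

/-! ### Counting spanning subgraphs by partition. -/

namespace SimpleGraph

variable {n : ℕ}

open scoped Classical in
/-- The sum of `g H` over the spanning subgraphs `H` of `F`. -/
noncomputable def subgraphSum {M : Type*} [AddCommMonoid M] (g : SimpleGraph (Fin n) → M)
    (F : SimpleGraph (Fin n)) : M :=
  ∑ H with H ≤ F, g H

/-- The vector of the numbers of spanning subgraphs of `F` with a given partition. -/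
noncomputable def partVec (F : SimpleGraph (Fin n)) : n.Partition → ℚ :=
  subgraphSum (fun H => Pi.single H.part 1) F

/-- Subgraphs split according to whether they contain the new edge. -/
theorem subgraphSum_sup_edge {M : Type*} [AddCommMonoid M] (g : SimpleGraph (Fin n) → M)
    {F : SimpleGraph (Fin n)} {u v : Fin n} (huv : u ≠ v) (h : ¬ F.Adj u v) :
    subgraphSum g (F ⊔ edge u v) =
      subgraphSum g F + subgraphSum (fun H => g (H ⊔ edge u v)) F := by
  classical
  unfold subgraphSum
  rw [← Finset.sum_filter_not_add_sum_filter _ (fun H => H.Adj u v), Finset.filter_filter,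
    Finset.filter_filter]
  congr 1
  · refine Finset.sum_congr (Finset.filter_congr fun H _ => ?_) fun _ _ => rfl
    constructor
    · rintro ⟨h1, h2⟩
      rw [← disjoint_edge] at h2
      exact h2.left_le_of_le_sup_right h1
    · exact fun h1 => ⟨h1.trans le_sup_left, fun h2 => h (h1 h2)⟩
  · refine Finset.sum_nbij' (fun H => H \ edge u v) (fun H => H ⊔ edge u v) ?_ ?_ ?_ ?_ ?_
    · intro H hH
      simp only [Finset.mem_filter, Finset.mem_univ, true_and] at hH ⊢
      exact sdiff_le_iff.mpr (sup_comm F _ ▸ hH.1)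
    · intro H hH
      simp only [Finset.mem_filter, Finset.mem_univ, true_and] at hH ⊢
      exact ⟨sup_le_sup_right hH _, by simp [edge_adj, huv]⟩
    · intro H hH
      simp only [Finset.mem_filter, Finset.mem_univ, true_and] at hH
      exact sdiff_edge_sup_edge hH.2
    · intro H hH
      simp only [Finset.mem_filter, Finset.mem_univ, true_and] at hH
      simp only [sup_sdiff_right_self]
      exact sdiff_edge _ fun h2 => h (hH h2)
    · intro H hH
      simp only [Finset.mem_filter, Finset.mem_univ, true_and] at hH
      rw [sdiff_edge_sup_edge hH.2]

theorem linearCombination_partVec {M : Type*} [AddCommGroup M] [Module ℚ M]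
    (q : n.Partition → M) (F : SimpleGraph (Fin n)) :
    Fintype.linearCombination ℚ q (partVec F) = subgraphSum (fun H => q H.part) F := by
  classical
  unfold partVec subgraphSum
  rw [map_sum]
  refine Finset.sum_congr rfl fun H _ => ?_
  rw [Fintype.linearCombination_apply_single, one_smul]

/-- Half of the triangularity: a subgraph has at least as many components as `F`, and equally many
only with the same components. -/
theorem partVec_apply_eq_zero {F : SimpleGraph (Fin n)} {ν : n.Partition}
    (h1 : ν.length ≤ F.part.length) (h2 : ν ≠ F.part) : partVec F ν = 0 := by
  classical
  unfold partVec subgraphSum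
  rw [Finset.sum_apply]
  refine Finset.sum_eq_zero fun H hH => ?_
  rw [Pi.single_apply, if_neg]
  rintro rfl
  exact h2 (part_eq_of_le_of_length_le (by simpa using hH) h1)

theorem partVec_part {F : SimpleGraph (Fin n)} (hF : F.IsAcyclic) : partVec F F.part = 1 := by
  classical
  unfold partVec subgraphSum
  rw [Finset.sum_apply, Finset.sum_eq_single_of_mem F (by simp)]
  · simp
  · intro H hH hne
    rw [Pi.single_apply, if_neg]
    intro h
    have hle : H ≤ F := by simpa using hH
    exact hne (hF.eq_of_le_of_reachable hle (reachable_of_le_of_length_le hle (by rw [h])))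

/-- `partVec` is invariant under relabelling of the vertices. -/
theorem partVec_comap (F : SimpleGraph (Fin n)) (σ : Equiv.Perm (Fin n)) :
    partVec (F.comap σ) = partVec F := by
  classical
  unfold partVec subgraphSum
  have hadj (H : SimpleGraph (Fin n)) : (H.comap σ.symm).comap σ = H := by
    ext; simp
  have hadj' (H : SimpleGraph (Fin n)) : (H.comap σ).comap σ.symm = H := by
    ext; simp
  refine Finset.sum_nbij' (fun H => H.comap σ.symm) (fun H => H.comap σ) ?_ ?_ ?_ ?_ ?_
  · intro H hH
    simp only [Finset.mem_filter, Finset.mem_univ, true_and] at hH ⊢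
    rw [← hadj' F]
    exact fun _ _ h => hH h
  · intro H hH
    simp only [Finset.mem_filter, Finset.mem_univ, true_and] at hH ⊢
    exact fun _ _ h => hH h
  · exact fun H _ => hadj H
  · exact fun H _ => hadj' H
  · intro H _
    rw [part_eq_of_reachable_iff (K := H.comap σ.symm) σ fun u v => ?_]
    exact (Iso.reachable_iff (φ := (⟨σ, by simp⟩ : H ≃g H.comap σ.symm))).symm

/-- Moving the edge `vw` of a forest to `uw`, where `uv` is another edge. -/
theorem partVec_move_edge {F : SimpleGraph (Fin n)} {u v w : Fin n} (huv : u ≠ v) (hvw : v ≠ w)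
    (huw : u ≠ w) (h1 : ¬ F.Adj u v) (h2 : ¬ F.Adj v w) (h3 : ¬ F.Adj u w) :
    partVec (F ⊔ edge v w ⊔ edge u v) - partVec (F ⊔ edge u w ⊔ edge u v) =
      partVec (F ⊔ edge v w) - partVec (F ⊔ edge u w) := by
  -- Once `u` and `v` are joined, attaching `w` to either has the same effect on components. Hence
  -- subgraphs containing both `uv` and the moved edge cancel in the difference.
  have key (H : SimpleGraph (Fin n)) :
      (H ⊔ edge v w ⊔ edge u v).part = (H ⊔ edge u w ⊔ edge u v).part := by
    refine part_eq_of_reachable_eq fun a b => ?_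
    rw [sup_right_comm H (edge v w), sup_right_comm H (edge u w),
      reachable_sup_edge_iff (G := H ⊔ edge u v) (u := v),
      reachable_sup_edge_iff (G := H ⊔ edge u v) (u := u)]
    have hr : (H ⊔ edge u v).Reachable u v := Adj.reachable (by simp [edge_adj, huv])
    have e1 (x) : (H ⊔ edge u v).Reachable x v ↔ (H ⊔ edge u v).Reachable x u :=
      ⟨fun h => h.trans hr.symm, fun h => h.trans hr⟩
    have e2 (x) : (H ⊔ edge u v).Reachable v x ↔ (H ⊔ edge u v).Reachable u x :=
      ⟨fun h => hr.trans h, fun h => hr.symm.trans h⟩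
    rw [e1, e2]
  have h1' : ¬ (F ⊔ edge v w).Adj u v := by simp [edge_adj, h1, huw, huv]
  have h1'' : ¬ (F ⊔ edge u w).Adj u v := by simp [edge_adj, h1, huv.symm, hvw]
  unfold partVec
  rw [subgraphSum_sup_edge _ huv h1', subgraphSum_sup_edge _ huv h1'',
    subgraphSum_sup_edge (fun H => Pi.single (H ⊔ edge u v).part 1) hvw h2,
    subgraphSum_sup_edge (fun H => Pi.single (H ⊔ edge u v).part 1) huw h3]
  simp only [key]
  abel

end SimpleGraph

/-! ### Reduction to star forests and the lattice filtration. -/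

namespace SimpleGraph

variable {n : ℕ}

/-- The lattice generated by the differences `partVec P - partVec N` of forests with `L`
components. -/
def forestLattice (n L : ℕ) : AddSubgroup (n.Partition → ℚ) :=
  AddSubgroup.closure {x | ∃ P N : SimpleGraph (Fin n),
    (P.IsAcyclic ∧ P.part.length = L) ∧ (N.IsAcyclic ∧ N.part.length = L) ∧
      x = partVec P - partVec N}

/-- With `F₀` the forest without `uv` and `vw`, `partVec_move_edge` reduces the difference to that
of `F₀ + vw` and `F₀ + uw`, which have one component more than `F`. -/
theorem exists_move_edge {F : SimpleGraph (Fin n)} (hF : F.IsAcyclic) {u v w : Fin n}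
    (h1 : F.Adj u v) (h2 : F.Adj v w) (huw : u ≠ w) :
    ∃ F' : SimpleGraph (Fin n), F'.IsAcyclic ∧
      (∀ a b, F'.Reachable a b ↔ F.Reachable a b) ∧ F'.Adj u w ∧
      (∀ a b, F.Adj a b → s(a, b) ≠ s(v, w) → F'.Adj a b) ∧
      partVec F - partVec F' ∈ forestLattice n (F.part.length + 1) := by
  have huv := h1.ne
  have hvw := h2.ne
  obtain ⟨F₀, hF₀⟩ : ∃ F₀, F₀ = (F \ edge v w) \ edge u v := ⟨_, rfl⟩
  have hF1 : F₀ ⊔ edge u v = F \ edge v w := by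
    rw [hF₀]
    exact sdiff_edge_sup_edge (by simp [edge_adj, h1, huv, huw])
  have hFe : F₀ ⊔ edge u v ⊔ edge v w = F := by rw [hF1, sdiff_edge_sup_edge h2]
  have hFe' : F₀ ⊔ edge v w ⊔ edge u v = F := by rw [sup_right_comm, hFe]
  have a1 : ¬ F₀.Adj u v := hF₀ ▸ not_adj_sdiff_edge
  have a2 : ¬ (F₀ ⊔ edge u v).Adj v w := hF1 ▸ not_adj_sdiff_edge
  have hac1 : (F₀ ⊔ edge u v).IsAcyclic := hF.anti (hFe ▸ le_sup_left)
  have r1 : ¬ F₀.Reachable u v := IsAcyclic.not_reachable_of_sup_edge huv a1 hac1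
  have r2 : ¬ (F₀ ⊔ edge u v).Reachable v w :=
    IsAcyclic.not_reachable_of_sup_edge hvw a2 (hFe.symm ▸ hF)
  have ruv : (F₀ ⊔ edge u v).Reachable u v := Adj.reachable (by simp [edge_adj, huv])
  have r3 : ¬ (F₀ ⊔ edge u v).Reachable u w := fun h => r2 (ruv.symm.trans h)
  have r2' : ¬ F₀.Reachable v w := fun h => r2 (h.mono le_sup_left)
  have r3' : ¬ F₀.Reachable u w := fun h => r3 (h.mono le_sup_left)
  have hac : (F₀ ⊔ edge u w ⊔ edge u v).IsAcyclic := by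
    rw [sup_right_comm]
    exact hac1.sup_edge_of_not_reachable r3
  have hcard : (F₀ ⊔ edge v w).part.length = F.part.length + 1 ∧
      (F₀ ⊔ edge u w).part.length = F.part.length + 1 := by
    have c1 := card_connectedComponent_sup_edge r1
    have c2 := card_connectedComponent_sup_edge r2
    have c3 := card_connectedComponent_sup_edge r2'
    have c4 := card_connectedComponent_sup_edge r3'
    rw [hFe] at c2
    simp only [part_length]
    omega
  refine ⟨F₀ ⊔ edge u w ⊔ edge u v, hac, fun a b => ?_, ?_, fun a b hab hne => ?_, ?_⟩
  · rw [← hFe, sup_right_comm,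
      reachable_sup_edge_iff (G := F₀ ⊔ edge u v) (u := u),
      reachable_sup_edge_iff (G := F₀ ⊔ edge u v) (u := v)]
    have e1 (x) : (F₀ ⊔ edge u v).Reachable x v ↔ (F₀ ⊔ edge u v).Reachable x u :=
      ⟨fun h => h.trans ruv.symm, fun h => h.trans ruv⟩
    have e2 (x) : (F₀ ⊔ edge u v).Reachable v x ↔ (F₀ ⊔ edge u v).Reachable u x :=
      ⟨fun h => ruv.trans h, fun h => ruv.symm.trans h⟩
    rw [e1, e2]
  · simp [edge_adj, huw]
  · rw [← hFe, sup_adj, adj_edge] at hab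
    rcases hab with hab | hab
    · rw [sup_right_comm]
      exact le_sup_left (a := F₀ ⊔ edge u v) (b := edge u w) hab
    · exact absurd hab.1.symm hne
  · have := partVec_move_edge huv hvw huw a1 (fun h => r2' h.reachable) (fun h => r3' h.reachable)
    rw [hFe'] at this
    rw [this]
    exact AddSubgroup.subset_closure ⟨_, _, ⟨hF.anti (hFe' ▸ le_sup_left), hcard.1⟩,
      ⟨hac.anti le_sup_left, hcard.2⟩, rfl⟩

/-- A forest is congruent to a star forest with the same components and prescribed centers. -/
theorem exists_star_forest (r : Fin n → Fin n) {F : SimpleGraph (Fin n)} (hF : F.IsAcyclic)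
    (hr : ∀ v, F.Reachable (r v) v) (hr' : ∀ u v, F.Reachable u v → r u = r v) :
    ∃ F' : SimpleGraph (Fin n), F'.IsAcyclic ∧ (∀ a b, F'.Reachable a b ↔ F.Reachable a b) ∧
      (∀ v, r v = v ∨ F'.Adj (r v) v) ∧
      partVec F - partVec F' ∈ forestLattice n (F.part.length + 1) := by
  classical
  induction hm : (Finset.univ.filter fun v => ¬ (r v = v ∨ F.Adj (r v) v)).card
    using Nat.strong_induction_on generalizing F with
  | _ m ih =>
  by_cases hstar : ∀ v, r v = v ∨ F.Adj (r v) v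
  · exact ⟨F, hF, fun _ _ => Iff.rfl, hstar, by rw [sub_self]; exact zero_mem _⟩
  push Not at hstar
  obtain ⟨x, hx⟩ := hstar
  obtain ⟨p⟩ := hr x
  -- The walk from the center `r x` to `x` leaves the closed neighborhood of the center along some
  -- `vw`; then `v` is a neighbor of the center and `w` can be moved to it.
  obtain ⟨d, -, hd1, hd2⟩ := p.exists_boundary_dart {y | y = r x ∨ F.Adj (r x) y} (Or.inl rfl)
    (by rintro (h | h); exacts [hx.1 h.symm, hx.2 h])
  obtain ⟨⟨v, w⟩, hvw⟩ := d
  simp only [Set.mem_ofPred_eq, not_or] at hvw hd1 hd2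
  have huv : F.Adj (r x) v := by
    rcases hd1 with rfl | h
    · exact absurd hvw hd2.2
    · exact h
  have hrw : r w = r x := (hr' _ _ ((hr x).symm.trans (huv.reachable.trans hvw.reachable))).symm
  have hrv : r v = r x := (hr' _ _ ((hr x).symm.trans huv.reachable)).symm
  obtain ⟨F', hF', hreach, hadj, hpres, hmem⟩ := exists_move_edge hF huv hvw (Ne.symm hd2.1)
  obtain ⟨F'', hF'', hreach', hstar, hmem'⟩ := ih
    -- The vertex `w` becomes adjacent to its center, and the only lost edge `vw` joins no vertex to
    -- its center.
    (Finset.univ.filter fun v => ¬ (r v = v ∨ F'.Adj (r v) v)).card (by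
      rw [← hm]
      refine Finset.card_lt_card (Finset.ssubset_iff_of_subset ?_ |>.mpr ⟨w, ?_, ?_⟩)
      · intro y hy
        simp only [Finset.mem_filter, Finset.mem_univ, true_and, not_or] at hy ⊢
        refine ⟨hy.1, fun h => hy.2 (hpres _ _ h fun he => ?_)⟩
        rcases Sym2.eq_iff.mp he with ⟨h1, h2⟩ | ⟨h1, h2⟩
        · rw [h2, hrw] at h1
          exact huv.ne h1
        · rw [h2, hrv] at h1
          exact hd2.1 h1.symm
      · simp only [Finset.mem_filter, Finset.mem_univ, true_and, not_or, hrw]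
        exact ⟨Ne.symm hd2.1, hd2.2⟩
      · simp [hrw, hadj]) hF'
    (fun v => (hreach _ _).mpr (hr v)) (fun u v h => hr' u v ((hreach _ _).mp h)) rfl
  refine ⟨F'', hF'', fun a b => (hreach' a b).trans (hreach a b), hstar, ?_⟩
  rw [part_eq_of_reachable_eq hreach] at hmem'
  have := add_mem hmem hmem'
  rwa [sub_add_sub_cancel] at this

theorem eq_star_of_isAcyclic {F : SimpleGraph (Fin n)} (hF : F.IsAcyclic) {r : Fin n → Fin n}
    (hr' : ∀ u v, F.Reachable u v → r u = r v) (hstar : ∀ v, r v = v ∨ F.Adj (r v) v)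
    (a b : Fin n) : F.Adj a b ↔ a ≠ b ∧ (r b = a ∨ r a = b) := by
  have : SimpleGraph.fromRel (fun a b => r b = a) = F := by
    refine hF.eq_of_le_of_reachable ?_ ?_
    · intro a b hab
      rw [fromRel_adj] at hab
      rcases hab with ⟨hne, rfl | rfl⟩
      · exact (hstar b).resolve_left hne
      · exact ((hstar a).resolve_left hne.symm).symm
    · have key (v) : (SimpleGraph.fromRel (fun a b => r b = a)).Reachable (r v) v := by
        by_cases h : r v = v
        · rw [h]
        · exact Adj.reachable (by simp [h])
      intro u v huv
      exact (key u).symm.trans (hr' u v huv ▸ key v)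
  conv_lhs => rw [← this]
  rw [fromRel_adj]

/-- Both forests reduce to star forests, and a permutation matching components and centers carries
one star forest to the other, leaving `partVec` unchanged. -/
theorem partVec_sub_mem_forestLattice {F K : SimpleGraph (Fin n)} (hF : F.IsAcyclic)
    (hK : K.IsAcyclic) (h : F.part = K.part) :
    partVec F - partVec K ∈ forestLattice n (F.part.length + 1) := by
  have hout (G : SimpleGraph (Fin n)) (c : G.ConnectedComponent) :
      G.connectedComponentMk (Quot.out c) = c := Quot.out_eq c
  have hr (G : SimpleGraph (Fin n)) (v : Fin n) :
      G.Reachable (Quot.out (G.connectedComponentMk v)) v :=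
    ConnectedComponent.exact (hout G _)
  have hr' (G : SimpleGraph (Fin n)) (u v : Fin n) (h : G.Reachable u v) :
      Quot.out (G.connectedComponentMk u) = Quot.out (G.connectedComponentMk v) := by
    rw [ConnectedComponent.sound h]
  obtain ⟨F', hF', hFr, hFs, hFm⟩ := exists_star_forest
    (fun v => Quot.out (F.connectedComponentMk v)) hF (hr F) (hr' F)
  obtain ⟨K', hK', hKr, hKs, hKm⟩ := exists_star_forest
    (fun v => Quot.out (K.connectedComponentMk v)) hK (hr K) (hr' K)
  obtain ⟨σ, -, hσ⟩ := exists_perm_of_part_eq h (fun c => Quot.out c) (hout F)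
    (fun c => Quot.out c) (hout K)
  have hFK : F' = K'.comap σ := by
    ext a b
    rw [comap_adj, eq_star_of_isAcyclic hF' (fun u v h => hr' F u v ((hFr u v).mp h)) hFs,
      eq_star_of_isAcyclic hK' (fun u v h => hr' K u v ((hKr u v).mp h)) hKs, ← hσ, ← hσ,
      σ.apply_eq_iff_eq, σ.apply_eq_iff_eq, σ.injective.ne_iff]
  rw [hFK, partVec_comap] at hFm
  rw [← h] at hKm
  have := sub_mem hFm hKm
  rwa [sub_sub_sub_cancel_right] at this

/-- An element of the lattice at level `L` is congruent modulo level `L + 1` to its part at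
level `L`. -/
theorem sub_sum_mem_forestLattice {B : n.Partition → SimpleGraph (Fin n)} (hB : IsForestBasis B)
    {L : ℕ} {x : n.Partition → ℚ} (hx : x ∈ forestLattice n L) :
    x - ∑ ν with ν.length = L, x ν • partVec (B ν) ∈ forestLattice n (L + 1) := by
  classical
  have single {P : SimpleGraph (Fin n)} (hP : P.IsAcyclic) (hL : P.part.length = L) :
      ∑ ν with ν.length = L, partVec P ν • partVec (B ν) = partVec (B P.part) := by
    rw [Finset.sum_eq_single_of_mem P.part (by simpa using hL), partVec_part hP, one_smul]
    intro ν hν hne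
    rw [partVec_apply_eq_zero _ hne, zero_smul]
    simp only [Finset.mem_filter, Finset.mem_univ, true_and] at hν
    rw [hν, hL]
  -- The claim is additive in `x`, so generators suffice, and integrality of the coefficients `x ν`
  -- never has to be discussed.
  induction hx using AddSubgroup.closure_induction with
  | mem x hx =>
    obtain ⟨P, N, ⟨hP, hPL⟩, ⟨hN, hNL⟩, rfl⟩ := hx
    simp only [Pi.sub_apply, sub_smul, Finset.sum_sub_distrib]
    rw [single hP hPL, single hN hNL, sub_sub_sub_comm]
    have h1 := partVec_sub_mem_forestLattice hP (hB.2 P.part) (hB.1 P.part).symm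
    have h2 := partVec_sub_mem_forestLattice hN (hB.2 N.part) (hB.1 N.part).symm
    rw [hPL] at h1
    rw [hNL] at h2
    exact sub_mem h1 h2
  | zero => simp
  | add x y _ _ hx hy =>
    simp only [Pi.add_apply, add_smul, Finset.sum_add_distrib]
    rw [add_sub_add_comm]
    exact add_mem hx hy
  | neg x _ hx =>
    simp only [Pi.neg_apply, neg_smul, Finset.sum_neg_distrib]
    rw [← neg_sub']
    exact neg_mem hx

theorem mem_forestLattice_of_forall_eq_zero {B : n.Partition → SimpleGraph (Fin n)}
    (hB : IsForestBasis B) {L : ℕ} {x : n.Partition → ℚ} (hx : x ∈ forestLattice n L) (k : ℕ)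
    (h : ∀ ν : n.Partition, ν.length < L + k → x ν = 0) : x ∈ forestLattice n (L + k) := by
  induction k with
  | zero => exact hx
  | succ k ih =>
    have := sub_sum_mem_forestLattice hB (ih fun ν hν => h ν (by omega))
    rwa [Finset.sum_eq_zero, sub_zero] at this
    intro ν hν
    simp only [Finset.mem_filter, Finset.mem_univ, true_and] at hν
    rw [h ν (by omega), zero_smul]

/-- Generators are differences, so the two families keep equal size: addition concatenates them and
negation swaps them. -/
theorem exists_eq_sum_of_mem_forestLattice {L : ℕ} {x : n.Partition → ℚ}
    (hx : x ∈ forestLattice n L) : ∃ (t : ℕ) (P N : Fin t → SimpleGraph (Fin n)),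
      (∀ i, (P i).IsAcyclic ∧ (P i).part.length = L) ∧
      (∀ i, (N i).IsAcyclic ∧ (N i).part.length = L) ∧
      x = ∑ i, partVec (P i) - ∑ i, partVec (N i) := by
  induction hx using AddSubgroup.closure_induction with
  | mem x hx =>
    obtain ⟨P, N, hP, hN, rfl⟩ := hx
    exact ⟨1, fun _ => P, fun _ => N, fun _ => hP, fun _ => hN, by simp⟩
  | zero => exact ⟨0, Fin.elim0, Fin.elim0, fun i => i.elim0, fun i => i.elim0, by simp⟩
  | add x y _ _ hx hy =>
    obtain ⟨t, P, N, hP, hN, rfl⟩ := hx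
    obtain ⟨t', P', N', hP', hN', rfl⟩ := hy
    refine ⟨t + t', Fin.append P P', Fin.append N N', ?_, ?_, ?_⟩
    · exact Fin.addCases (by simpa using hP) (by simpa using hP')
    · exact Fin.addCases (by simpa using hN) (by simpa using hN')
    · simp only [Fin.sum_univ_add, Fin.append_left, Fin.append_right]
      abel
  | neg x _ hx =>
    obtain ⟨t, P, N, hP, hN, rfl⟩ := hx
    exact ⟨t, N, P, hN, hP, by abel⟩

end SimpleGraph

/-! ### Power sum expansion of the chromatic symmetric function. -/

theorem linearIndependent_of_triangular {ι α M : Type*} [Fintype ι] [LinearOrder α]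
    [AddCommGroup M] [Module ℚ M] (v : ι → M) (φ : ι → M →ₗ[ℚ] ℚ) (len : ι → α)
    (hd : ∀ i, φ i (v i) ≠ 0) (h : ∀ i j, i ≠ j → len j ≤ len i → φ j (v i) = 0) :
    LinearIndependent ℚ v := by
  classical
  rw [Fintype.linearIndependent_iff]
  intro g hg
  by_contra! hne
  obtain ⟨i, hi⟩ := hne
  -- At an index of least `len` in the support of the relation, `φ j` kills every other term.
  obtain ⟨j, hj, hmin⟩ := Finset.exists_min_image (Finset.univ.filter fun i => g i ≠ 0) len
    ⟨i, by simpa using hi⟩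
  simp only [Finset.mem_filter, Finset.mem_univ, true_and] at hj hmin
  have := congrArg (φ j) hg
  rw [map_sum, map_zero, Finset.sum_eq_single j, map_smul, smul_eq_mul] at this
  · exact mul_ne_zero hj (hd j) this
  · intro i _ hij
    rw [map_smul]
    by_cases hi : g i = 0
    · rw [hi, zero_smul]
    · rw [h i j hij (hmin i hi), smul_zero]
  · simp

namespace SimpleGraph

variable {n : ℕ}

/-- The monomial of a coloring. -/
noncomputable def colorMonomial (κ : Fin n → ℕ+) : ℕ+ →₀ ℕ := ∑ v, Finsupp.single (κ v) 1

theorem colorMonomial_apply (κ : Fin n → ℕ+) (i : ℕ+) :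
    colorMonomial κ i = Fintype.card {v // κ v = i} := by
  rw [colorMonomial, Finsupp.finsetSum_apply, Fintype.card_subtype, Finset.card_filter]
  exact Finset.sum_congr rfl fun v _ => Finsupp.single_apply

theorem colorMonomial_comp (κ : Fin n → ℕ+) (σ : Equiv.Perm (Fin n)) :
    colorMonomial (κ ∘ σ) = colorMonomial κ :=
  Equiv.sum_comp σ fun v => Finsupp.single (κ v) 1

theorem exists_perm_of_colorMonomial_eq {κ κ' : Fin n → ℕ+}
    (h : colorMonomial κ = colorMonomial κ') :
    ∃ σ : Equiv.Perm (Fin n), ∀ v, κ' (σ v) = κ v := by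
  have hcard (i : ℕ+) : Fintype.card {v // κ v = i} = Fintype.card {v // κ' v = i} := by
    rw [← colorMonomial_apply, h, colorMonomial_apply]
  exact ⟨(Equiv.sigmaFiberEquiv κ).symm.trans
    ((Equiv.sigmaCongrRight fun i => Fintype.equivOfCardEq (hcard i)).trans
      (Equiv.sigmaFiberEquiv κ')), fun v => (Fintype.equivOfCardEq (hcard (κ v)) ⟨v, rfl⟩).2⟩

/-- The finite set of colorings with a given monomial. -/
noncomputable def coloringsOfMonomial (n : ℕ) (m : ℕ+ →₀ ℕ) : Finset (Fin n → ℕ+) :=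
  (Fintype.piFinset fun _ => m.support).filter fun κ => colorMonomial κ = m

theorem mem_coloringsOfMonomial {m : ℕ+ →₀ ℕ} {κ : Fin n → ℕ+} :
    κ ∈ coloringsOfMonomial n m ↔ colorMonomial κ = m := by
  rw [coloringsOfMonomial, Finset.mem_filter, Fintype.mem_piFinset, and_iff_right_iff_imp]
  rintro rfl v
  rw [Finsupp.mem_support_iff, colorMonomial_apply]
  exact (Fintype.card_pos_iff.mpr ⟨⟨v, rfl⟩⟩).ne'

/-- The graph joining distinct vertices of the same color. -/
def colorGraph (κ : Fin n → ℕ+) : SimpleGraph (Fin n) where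
  Adj a b := a ≠ b ∧ κ a = κ b
  symm := ⟨fun _ _ h => ⟨h.1.symm, h.2.symm⟩⟩
  loopless := ⟨fun _ h => h.1 rfl⟩

theorem colorGraph_reachable_iff (κ : Fin n → ℕ+) (a b : Fin n) :
    (colorGraph κ).Reachable a b ↔ κ a = κ b := by
  constructor
  · rintro ⟨p⟩
    induction p with
    | nil => rfl
    | cons h _ ih => exact h.2.trans ih
  · intro h
    by_cases hab : a = b
    · exact hab ▸ .refl _
    · exact Adj.reachable ⟨hab, h⟩

theorem le_colorGraph_iff {H : SimpleGraph (Fin n)} {κ : Fin n → ℕ+} :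
    H ≤ colorGraph κ ↔ ∀ a b, H.Reachable a b → κ a = κ b := by
  constructor
  · exact fun h a b hab => (colorGraph_reachable_iff κ a b).mp (hab.mono h)
  · exact fun h a b hab => ⟨hab.ne, h a b hab.reachable⟩

theorem inf_colorGraph_eq_bot_iff {F : SimpleGraph (Fin n)} {κ : Fin n → ℕ+} :
    F ⊓ colorGraph κ = ⊥ ↔ ∀ a b, F.Adj a b → κ a ≠ κ b := by
  rw [← disjoint_iff, disjoint_left]
  exact forall₂_congr fun a b => forall_congr' fun h => not_congr (and_iff_right h.ne)

theorem part_colorGraph_eq {κ κ' : Fin n → ℕ+} (h : colorMonomial κ = colorMonomial κ') :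
    (colorGraph κ).part = (colorGraph κ').part := by
  obtain ⟨σ, hσ⟩ := exists_perm_of_colorMonomial_eq h
  refine part_eq_of_reachable_iff σ fun u v => ?_
  rw [colorGraph_reachable_iff, colorGraph_reachable_iff, hσ, hσ]

open scoped Classical in
/-- The generating function of the colorings that are constant on the components of `H`,
a product of power sums. -/
noncomputable def constSeries (H : SimpleGraph (Fin n)) : MvPowerSeries ℕ+ ℚ :=
  fun m => ∑ κ ∈ coloringsOfMonomial n m, if H ≤ colorGraph κ then 1 else 0

/-- A permutation matching the components transports the colorings without changing their monomials.
-/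
theorem constSeries_eq_of_part_eq {H K : SimpleGraph (Fin n)} (h : H.part = K.part) :
    constSeries H = constSeries K := by
  classical
  obtain ⟨σ, hσ, -⟩ := exists_perm_of_part_eq h (fun c => Quot.out c) (fun c => Quot.out_eq c)
    (fun c => Quot.out c) (fun c => Quot.out_eq c)
  funext m
  refine Finset.sum_nbij' (fun κ => κ ∘ σ.symm) (fun κ => κ ∘ σ) ?_ ?_ ?_ ?_ ?_
  · intro κ hκ
    rw [mem_coloringsOfMonomial] at hκ ⊢
    rw [colorMonomial_comp, hκ]
  · intro κ hκ
    rw [mem_coloringsOfMonomial] at hκ ⊢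
    rw [colorMonomial_comp, hκ]
  · intro κ _
    ext; simp
  · intro κ _
    ext; simp
  · intro κ _
    refine if_congr ?_ rfl rfl
    rw [le_colorGraph_iff, le_colorGraph_iff]
    constructor
    · intro h a b hab
      exact h _ _ ((hσ _ _).mpr (by simpa using hab))
    · intro h a b hab
      simpa using h _ _ ((hσ _ _).mp hab)

/-- If `S` has an edge, toggling it pairs subgraphs of opposite sign. -/
theorem subgraphSum_neg_one_pow (S : SimpleGraph (Fin n)) [Decidable (S = ⊥)] :
    subgraphSum (fun H => (-1 : ℚ) ^ H.edgeSet.ncard) S = if S = ⊥ then 1 else 0 := by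
  classical
  split_ifs with h
  · subst h
    unfold subgraphSum
    rw [Finset.sum_eq_single_of_mem ⊥ (by simp)]
    · simp
    · intro H hH hne
      exact absurd (by simpa using hH) hne
  · obtain ⟨u, v, huv⟩ := ne_bot_iff_exists_adj.mp h
    rw [← sdiff_edge_sup_edge huv, subgraphSum_sup_edge _ huv.ne not_adj_sdiff_edge]
    unfold subgraphSum
    rw [← Finset.sum_add_distrib]
    refine Finset.sum_eq_zero fun H hH => ?_
    simp only [Finset.mem_filter, Finset.mem_univ, true_and] at hH
    rw [ncard_edgeSet_sup_edge huv.ne fun h => not_adj_sdiff_edge (hH h), pow_succ]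
    ring

/-- Inclusion–exclusion over monochromatic edges: `κ` is proper exactly when `F ⊓ colorGraph κ` is
empty, and this indicator is a signed sum over its subgraphs. -/
theorem csf_eq_subgraphSum (F : SimpleGraph (Fin n)) :
    F.csf = subgraphSum (fun H => (-1 : ℚ) ^ H.edgeSet.ncard • constSeries H) F := by
  classical
  funext m
  have hcard : Nat.card {κ : F.Coloring ℕ+ // ∑ v, Finsupp.single (κ v) 1 = m} =
      ((coloringsOfMonomial n m).filter fun κ => F ⊓ colorGraph κ = ⊥).card := by
    rw [← Nat.card_eq_finsetCard]
    refine Nat.card_congr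
      { toFun := fun κ => ⟨fun v => κ.1 v, Finset.mem_filter.mpr
          ⟨mem_coloringsOfMonomial.mpr κ.2, inf_colorGraph_eq_bot_iff.mpr fun _ _ h => κ.1.valid h⟩⟩
        invFun := fun κ => ⟨Coloring.mk κ.1
            fun h => inf_colorGraph_eq_bot_iff.mp (Finset.mem_filter.mp κ.2).2 _ _ h,
          mem_coloringsOfMonomial.mp (Finset.mem_filter.mp κ.2).1⟩
        left_inv := fun _ => rfl
        right_inv := fun _ => rfl }
  have hsum : subgraphSum (fun H => (-1 : ℚ) ^ H.edgeSet.ncard • constSeries H) F m =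
      subgraphSum (fun H => (-1 : ℚ) ^ H.edgeSet.ncard * constSeries H m) F := by
    unfold subgraphSum
    exact Finset.sum_apply m _ _
  rw [hsum]
  refine (congrArg (Nat.cast : ℕ → ℚ) hcard).trans ?_
  rw [Finset.card_filter, Nat.cast_sum]
  unfold subgraphSum constSeries
  simp only [Finset.mul_sum]
  rw [Finset.sum_comm]
  refine Finset.sum_congr rfl fun κ _ => ?_
  rw [Nat.cast_ite, Nat.cast_one, Nat.cast_zero, ← subgraphSum_neg_one_pow]
  unfold subgraphSum
  simp only [mul_ite, mul_one, mul_zero]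
  rw [← Finset.sum_filter, Finset.filter_filter]
  simp only [le_inf_iff]

theorem neg_one_pow_ncard_edgeSet {H : SimpleGraph (Fin n)} (hH : H.IsAcyclic) :
    (-1 : ℚ) ^ H.edgeSet.ncard = (-1) ^ (n - H.part.length) := by
  have := hH.card_edgeSet_add_card_connectedComponent
  rw [← part_length, Nat.card_fin] at this
  congr 1
  omega

/-- The linear map from part vectors to chromatic symmetric functions. -/
noncomputable def csfMap (B : n.Partition → SimpleGraph (Fin n)) :
    (n.Partition → ℚ) →ₗ[ℚ] MvPowerSeries ℕ+ ℚ :=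
  Fintype.linearCombination ℚ fun ν => (-1 : ℚ) ^ (n - ν.length) • constSeries (B ν)

theorem csf_eq_csfMap {B : n.Partition → SimpleGraph (Fin n)} (hB : IsChromaticBasis B)
    {F : SimpleGraph (Fin n)} (hF : F.IsAcyclic) : F.csf = csfMap B (partVec F) := by
  classical
  rw [csf_eq_subgraphSum, csfMap, linearCombination_partVec]
  refine Finset.sum_congr rfl fun H hH => ?_
  dsimp only
  rw [neg_one_pow_ncard_edgeSet (hF.anti (by simpa using hH)),
    constSeries_eq_of_part_eq (hB H.part)]

/-- Linear independence of power sums, tested on the monomial of a coloring whose color classes are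
exactly the components of `B ν`. -/
theorem csfMap_injective {B : n.Partition → SimpleGraph (Fin n)} (hB : IsChromaticBasis B) :
    Function.Injective (csfMap B) := by
  classical
  have hκ (ν : n.Partition) : ∃ κ : Fin n → ℕ+, ∀ a b, (B ν).Reachable a b ↔ κ a = κ b := by
    obtain ⟨f⟩ : Nonempty ((B ν).ConnectedComponent ↪ ℕ+) :=
      ⟨(Fintype.equivFin _).toEmbedding.trans
        ⟨fun i => ⟨i + 1, Nat.succ_pos _⟩, fun i j h => by
          simpa [Fin.ext_iff] using congrArg PNat.val h⟩⟩
    exact ⟨fun v => f ((B ν).connectedComponentMk v), fun a b => by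
      rw [f.apply_eq_iff_eq, ConnectedComponent.eq]⟩
  choose κ hκ using hκ
  have hpart (ν : n.Partition) : (colorGraph (κ ν)).part = ν := by
    rw [← hB ν]
    refine part_eq_of_reachable_eq fun u v => ?_
    rw [colorGraph_reachable_iff, hB, hκ]
  refine (linearIndependent_of_triangular _
    -- The order is reversed: a coloring constant on the components of `B ν` has at most `ν.length`
    -- classes, with equality only if the classes are those components.
    (fun ν => MvPowerSeries.coeff (colorMonomial (κ ν))) (fun ν => OrderDual.toDual ν.length)
    ?_ ?_).fintypeLinearCombination_injective
  · intro ν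
    rw [map_smul, smul_eq_mul]
    refine mul_ne_zero (pow_ne_zero _ (by norm_num)) (ne_of_gt ?_)
    refine Finset.sum_pos' (fun κ _ => by split_ifs <;> norm_num)
      ⟨κ ν, mem_coloringsOfMonomial.mpr rfl, ?_⟩
    rw [if_pos (le_colorGraph_iff.mpr fun a b h => (hκ ν a b).mp h)]
    exact one_pos
  · intro ν ρ hne hlen
    rw [map_smul, smul_eq_mul]
    refine mul_eq_zero_of_right _ (Finset.sum_eq_zero fun κ' hκ' => if_neg fun hle => hne ?_)
    have h1 := part_colorGraph_eq (mem_coloringsOfMonomial.mp hκ')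
    rw [hpart] at h1
    have h2 := part_eq_of_le_of_length_le hle (by rw [h1, hB]; exact hlen)
    rw [← hB ν, h2, h1]

end SimpleGraph

/-! ### The `U`-polynomial and expansions in a forest-basis. -/

namespace SimpleGraph

variable {n : ℕ}

theorem count_part (G : SimpleGraph (Fin n)) (i : ℕ) :
    G.part.parts.count i = Nat.card {c : G.ConnectedComponent // c.supp.ncard = i} := by
  classical
  rw [Nat.card_eq_fintype_card, Fintype.card_subtype]
  simp only [part, Multiset.count_map, Finset.card_def, Finset.filter_val]
  simp only [eq_comm (a := i)]

theorem prod_X_pow_eq_monomial (G : SimpleGraph (Fin n)) :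
    ∏ i ∈ Finset.Icc 1 n, (MvPolynomial.X i : MvPolynomial ℕ (Polynomial ℚ)) ^
      Nat.card {c : G.ConnectedComponent // c.supp.ncard = i} =
      MvPolynomial.monomial (Multiset.toFinsupp G.part.parts) 1 := by
  rw [MvPolynomial.monomial_eq, map_one, one_mul, Finsupp.prod_of_support_subset (s := Finset.Icc 1 n)]
  · simp only [Multiset.toFinsupp_apply, count_part]
  · intro i hi
    rw [Multiset.toFinsupp_support, Multiset.mem_toFinset] at hi
    exact Finset.mem_Icc.mpr ⟨G.part.parts_pos hi, Nat.Partition.le_of_mem_parts hi⟩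
  · simp

/-- The linear map from part vectors to `U`-polynomials. -/
noncomputable def uMap (n : ℕ) : (n.Partition → ℚ) →ₗ[ℚ] MvPolynomial ℕ (Polynomial ℚ) :=
  Fintype.linearCombination ℚ fun ν => MvPolynomial.monomial (Multiset.toFinsupp ν.parts) 1

/-- Every edge subset of a forest is acyclic, so the exponent of `y - 1` is zero throughout. -/
theorem uPoly_eq_uMap {F : SimpleGraph (Fin n)} (hF : F.IsAcyclic) :
    F.uPoly = uMap n (partVec F) := by
  classical
  rw [uMap, linearCombination_partVec]
  unfold uPoly subgraphSum
  have hedge {A : Finset (Sym2 (Fin n))} (hA : (A : Set (Sym2 (Fin n))) ⊆ F.edgeSet) :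
      (fromEdgeSet (A : Set (Sym2 (Fin n)))).edgeSet = A := by
    rw [edgeSet_fromEdgeSet, sdiff_eq_left, Set.disjoint_left]
    exact fun e he => F.not_isDiag_of_mem_edgeSet (hA he)
  refine Finset.sum_nbij' (fun A => fromEdgeSet (A : Set (Sym2 (Fin n))))
    (fun H => H.edgeSet.toFinset) ?_ ?_ ?_ ?_ ?_
  · intro A hA
    rw [Finset.mem_powerset, ← Finset.coe_subset, coe_edgeFinset] at hA
    simp only [Finset.mem_filter, Finset.mem_univ, true_and]
    rw [← edgeSet_subset_edgeSet, hedge hA]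
    exact hA
  · intro H hH
    simp only [Finset.mem_filter, Finset.mem_univ, true_and] at hH
    rw [Finset.mem_powerset, ← Finset.coe_subset, coe_edgeFinset, Set.coe_toFinset]
    exact edgeSet_subset_edgeSet.mpr hH
  · intro A hA
    rw [Finset.mem_powerset, ← Finset.coe_subset, coe_edgeFinset] at hA
    apply Finset.coe_injective
    rw [Set.coe_toFinset, hedge hA]
  · intro H _
    rw [Set.coe_toFinset, fromEdgeSet_edgeSet]
  · intro A hA
    rw [Finset.mem_powerset, ← Finset.coe_subset, coe_edgeFinset] at hA
    have hle : fromEdgeSet (A : Set (Sym2 (Fin n))) ≤ F := by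
      rw [← edgeSet_subset_edgeSet, hedge hA]
      exact hA
    have hc := (hF.anti hle).card_edgeSet_add_card_connectedComponent
    rw [hedge hA, Set.ncard_coe_finset, Nat.card_eq_fintype_card (α := Fin n)] at hc
    rw [hc, Nat.sub_self, pow_zero, map_one, mul_one, Fintype.card_fin, prod_X_pow_eq_monomial]

theorem uCoeff_eq {F : SimpleGraph (Fin n)} (hF : F.IsAcyclic) (ν : n.Partition) :
    F.uCoeff ν = Polynomial.C (partVec F ν) := by
  classical
  rw [uCoeff, uPoly_eq_uMap hF, uMap, Fintype.linearCombination_apply, MvPolynomial.coeff_sum,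
    Finset.sum_eq_single ν]
  · rw [MvPolynomial.coeff_smul, MvPolynomial.coeff_monomial, if_pos rfl,
      Polynomial.smul_eq_C_mul, mul_one]
  · intro ρ _ hne
    rw [MvPolynomial.coeff_smul, MvPolynomial.coeff_monomial, if_neg, smul_zero]
    exact fun h => hne (Nat.Partition.ext (Multiset.toFinsupp.injective h))
  · simp

theorem linearIndependent_partVec {B : n.Partition → SimpleGraph (Fin n)} (hB : IsForestBasis B) :
    LinearIndependent ℚ fun ν => partVec (B ν) := by
  refine linearIndependent_of_triangular _ (fun ν => LinearMap.proj ν) Nat.Partition.length ?_ ?_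
  · intro ν
    have := partVec_part (hB.2 ν)
    rw [hB.1 ν] at this
    simp [this]
  · intro ν ρ hne hlen
    rw [LinearMap.proj_apply]
    exact partVec_apply_eq_zero (by rwa [hB.1]) (by rw [hB.1]; exact hne.symm)

theorem isCSFExpansion_iff {B : n.Partition → SimpleGraph (Fin n)} (hB : IsForestBasis B)
    {F : SimpleGraph (Fin n)} (hF : F.IsAcyclic) (c : n.Partition → ℚ) :
    IsCSFExpansion B F c ↔ partVec F = ∑ ν, c ν • partVec (B ν) := by
  unfold IsCSFExpansion
  rw [← (csfMap_injective hB.1).eq_iff, csf_eq_csfMap hB.1 hF, map_sum]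
  simp only [map_smul, csf_eq_csfMap hB.1 (hB.2 _)]

/-- The independent vectors `partVec (B ν)` are as many as the dimension of the space, hence a basis
of it. -/
theorem existsUnique_isCSFExpansion {B : n.Partition → SimpleGraph (Fin n)} (hB : IsForestBasis B)
    {F : SimpleGraph (Fin n)} (hF : F.IsAcyclic) :
    ∃! c : n.Partition → ℚ, IsCSFExpansion B F c := by
  have hli := linearIndependent_partVec hB
  have hspan := hli.span_eq_top_of_card_eq_finrank' (by simp)
  obtain ⟨c, hc⟩ := (Submodule.mem_span_range_iff_exists_fun ℚ).mp
    (hspan ▸ Submodule.mem_top : partVec F ∈ Submodule.span ℚ (Set.range fun ν => partVec (B ν)))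
  refine ⟨c, (isCSFExpansion_iff hB hF c).mpr hc.symm, fun d hd => ?_⟩
  apply hli.fintypeLinearCombination_injective
  rw [Fintype.linearCombination_apply, Fintype.linearCombination_apply, hc]
  exact ((isCSFExpansion_iff hB hF d).mp hd).symm

theorem partVec_eq_sum_csfCoeff {B : n.Partition → SimpleGraph (Fin n)} (hB : IsForestBasis B)
    {F : SimpleGraph (Fin n)} (hF : F.IsAcyclic) :
    partVec F = ∑ ν, csfCoeff B F ν • partVec (B ν) :=
  (isCSFExpansion_iff hB hF _).mp
    (Classical.epsilon_spec (existsUnique_isCSFExpansion hB hF).exists)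

theorem csfCoeff_eq_of_csfTrunc_sub_eq_zero {B : n.Partition → SimpleGraph (Fin n)}
    (hB : IsForestBasis B) {F₁ F₂ : SimpleGraph (Fin n)} {k : ℕ} (hpart : F₁.part = F₂.part)
    (hk : csfTrunc B F₁ k - csfTrunc B F₂ k = 0) {ν : n.Partition}
    (hν : ν.length ≤ F₂.part.length + k) : csfCoeff B F₁ ν - csfCoeff B F₂ ν = 0 := by
  unfold csfTrunc at hk
  rw [hpart, ← Finset.sum_sub_distrib] at hk
  simp only [← sub_smul, csf_eq_csfMap hB.1 (hB.2 _)] at hk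
  simp only [← map_smul, ← map_sum] at hk
  rw [map_eq_zero_iff _ (csfMap_injective hB.1)] at hk
  exact linearIndependent_iff'.mp (linearIndependent_partVec hB) _ _ hk ν (by simpa using hν)

end SimpleGraph

/-! ### The main theorem. -/

theorem mainTheorem8 (n : ℕ) (F₁ F₂ : SimpleGraph (Fin n)) (hF₁ : F₁.IsAcyclic)
    (hF₂ : F₂.IsAcyclic) (μ : n.Partition) (hμ₁ : F₁.part = μ) (hμ₂ : F₂.part = μ)
    (B : n.Partition → SimpleGraph (Fin n)) (hB : IsForestBasis B) (k : ℕ)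
    (hk : csfTrunc B F₁ k - csfTrunc B F₂ k = 0) :
    -- the coefficients `[ν]X_{F₁, B}` and `[ν]X_{F₂, B}` are well defined
    ((∃! c : n.Partition → ℚ, IsCSFExpansion B F₁ c) ∧
      (∃! c : n.Partition → ℚ, IsCSFExpansion B F₂ c)) ∧
    -- the same signed sum of forests at level `ℓ(μ) + k + 1` for `X` and for `U`
    (∃ (t : ℕ) (P N : Fin t → SimpleGraph (Fin n)),
      (∀ i, (P i).IsAcyclic ∧ (P i).part.length = μ.length + k + 1) ∧
      (∀ i, (N i).IsAcyclic ∧ (N i).part.length = μ.length + k + 1) ∧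
      F₁.csf - F₂.csf = ∑ i, (P i).csf - ∑ i, (N i).csf ∧
      F₁.uPoly - F₂.uPoly = ∑ i, (P i).uPoly - ∑ i, (N i).uPoly) ∧
    -- equality of the coefficient differences
    (∀ ν : n.Partition, ν.length ≤ μ.length + k + 1 →
      Polynomial.C (csfCoeff B F₁ ν - csfCoeff B F₂ ν) = F₁.uCoeff ν - F₂.uCoeff ν) := by
  subst hμ₂
  have hzero {ν : n.Partition} := SimpleGraph.csfCoeff_eq_of_csfTrunc_sub_eq_zero hB hμ₁ hk (ν := ν)
  -- In the expansion of the difference, terms with `ρ.length ≤ ℓ(μ) + k` have coefficient zero. Any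
  -- remaining `ρ` is at least as long as `ν`, so by triangularity only `ρ = ν` contributes.
  have hdiff (ν : n.Partition) (hν : ν.length ≤ F₂.part.length + k + 1) :
      SimpleGraph.partVec F₁ ν - SimpleGraph.partVec F₂ ν = csfCoeff B F₁ ν - csfCoeff B F₂ ν := by
    have h1 := congrFun (SimpleGraph.partVec_eq_sum_csfCoeff hB hF₁) ν
    have h2 := congrFun (SimpleGraph.partVec_eq_sum_csfCoeff hB hF₂) ν
    rw [h1, h2]
    simp only [Finset.sum_apply, Pi.smul_apply, smul_eq_mul]
    rw [← Finset.sum_sub_distrib, Finset.sum_eq_single ν]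
    · have := SimpleGraph.partVec_part (hB.2 ν)
      rw [hB.1] at this
      rw [this, mul_one, mul_one]
    · intro ρ _ hne
      rw [← sub_mul]
      by_cases hρ : ρ.length ≤ F₂.part.length + k
      · rw [hzero hρ, zero_mul]
      · rw [SimpleGraph.partVec_apply_eq_zero (by rw [hB.1]; omega) (by rw [hB.1]; exact hne.symm), mul_zero]
    · simp
  refine ⟨⟨SimpleGraph.existsUnique_isCSFExpansion hB hF₁, SimpleGraph.existsUnique_isCSFExpansion hB hF₂⟩, ?_, ?_⟩
  · have hmem : SimpleGraph.partVec F₁ - SimpleGraph.partVec F₂ ∈ SimpleGraph.forestLattice n F₂.part.length :=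
      AddSubgroup.subset_closure ⟨F₁, F₂, ⟨hF₁, by rw [hμ₁]⟩, ⟨hF₂, rfl⟩, rfl⟩
    obtain ⟨t, P, N, hP, hN, hPN⟩ := SimpleGraph.exists_eq_sum_of_mem_forestLattice
      -- Coordinates vanish for lengths from `ℓ(μ)` to `ℓ(μ) + k`, which is `k + 1` levels.
      (SimpleGraph.mem_forestLattice_of_forall_eq_zero hB hmem (k + 1) fun ν hν => by
        rw [Pi.sub_apply, hdiff ν (by omega), hzero (by omega)])
    refine ⟨t, P, N, hP, hN, ?_, ?_⟩
    · have := congrArg (SimpleGraph.csfMap B) hPN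
      simp only [map_sub, map_sum] at this
      simpa only [SimpleGraph.csf_eq_csfMap hB.1 hF₁, SimpleGraph.csf_eq_csfMap hB.1 hF₂,
        SimpleGraph.csf_eq_csfMap hB.1 (hP _).1, SimpleGraph.csf_eq_csfMap hB.1 (hN _).1] using this
    · have := congrArg (SimpleGraph.uMap n) hPN
      simp only [map_sub, map_sum] at this
      simpa only [SimpleGraph.uPoly_eq_uMap hF₁, SimpleGraph.uPoly_eq_uMap hF₂,
        SimpleGraph.uPoly_eq_uMap (hP _).1, SimpleGraph.uPoly_eq_uMap (hN _).1] using this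
  · intro ν hν
    rw [SimpleGraph.uCoeff_eq hF₁, SimpleGraph.uCoeff_eq hF₂, ← Polynomial.C_sub, hdiff ν hν]
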